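/- Assume Ostaszewski's principle $\clubsuit$: there is a family $(S_\alpha)$, indexed by the countable (nonzero) limit ordinals $\alpha$, such that each $S_\alpha$ is an infinite subset of $\alpha$ converging to $\alpha$ in the order topology (that is, $S_\alpha\cap[0,\beta]$ is finite for every $\beta<\alpha$), and every uncountable $X\subseteq\omega_1$ contains some $S_\alpha$ as a subset. Then for every integer $n\ge 1$ there is a topology $\tau$ on the set $[0,\omega_1]$ which is compact, Hausdorff, scattered (every nonempty subset has a relatively isolated point), non-separable, of height $\omega+1$ (the least ordinal $\beta$ for which the $\beta$-th Cantor–Bendixson derivative is empty is $\omega+1$), of weight $\omega_1$ (the least cardinality of a base of $\tau$ is $\aleph_1$) and $(n+1)$-diverse, and in which the set $[0,\alpha+(n-1)]\cup\{\omega_1\}$ is closed for every $\alpha<\omega_1$. Moreover, there is a function $\phi:[0,\omega_1)\to[0,\omega_1)$ which is continuous from the subspace topology induced by $\tau$ to the order topology and satisfies $|\phi^{-1}[\{\alpha\}]|\le n$ for all $\alpha<\omega_1$; in particular $\phi$ is finite-to-one. Here, for a partition $F_1,\dots,F_k$ of $\{1,\dots,m\}$, a point $(x_1,\dots,x_m)\in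 K^m$ is called $(F_1,\dots,F_k)$-diverse if $\{x_j:j\in F_i\}\cap\{x_j:j\notin F_i\}=\emptyset$ for all $1\le i\le k$. A compact Hausdorff space $K$ is called $N$-diverse if for every $m\in\mathbb N$ and every partition $F_1,\dots,F_k$ of $\{1,\dots,m\}$ with $k\le N$, every sequence $(x^\alpha)_{\alpha<\omega_1}$ of $(F_1,\dots,F_k)$-diverse points of $K^m$ has a cluster point $z\in K^m$ which is $(F_1,\dots,F_k)$-diverse, where $z$ is a cluster point if each of its neighbourhoods contains $x^\alpha$ for infinitely many $\alpha<\omega_1$. -/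

import Mathlib

open Set Topology CantorBendixson
open scoped Ordinal Cardinal

/-- Ostaszewski's principle `♣`: there are sets `S α`, for `α` a countable limit ordinal
(zero is not a limit), such that `S α` is an infinite subset of `α` converging to `α` in the order
topology (only finitely many elements of `S α` lie in each `[0, β]` with `β < α`), and every
uncountable subset of `ω₁` includes some `S α`. -/
def Clubsuit : Prop :=
  ∃ S : Ordinal.{0} → Set Ordinal.{0},
    (∀ α, α < ω₁ → Order.IsSuccLimit α →
      S α ⊆ Iio α ∧ (S α).Infinite ∧ ∀ β < α, (S α ∩ Iic β).Finite) ∧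
    ∀ X : Set Ordinal.{0}, X ⊆ Iio ω₁ → ¬ X.Countable →
      ∃ α, α < ω₁ ∧ Order.IsSuccLimit α ∧ S α ⊆ X

/-- `F 0, …, F (k-1)` is a partition of the index set of `m` coordinates. Empty pieces are allowed;
they impose no condition on diverse points. -/
def IsPartition {m k : ℕ} (F : Fin k → Set (Fin m)) : Prop :=
  Pairwise (fun i j => Disjoint (F i) (F j)) ∧ ⋃ i, F i = univ

/-- The point `x` of `K ^ m` is `(F 0, …, F (k-1))`-diverse. -/
def IsDiversePoint {K : Type*} {m k : ℕ} (F : Fin k → Set (Fin m)) (x : Fin m → K) : Prop :=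
  ∀ i, Disjoint (x '' F i) (x '' (F i)ᶜ)

/-- `z` is a cluster point of the `ω₁`-sequence `x`: every neighbourhood of `z` contains `x α` for
infinitely many indices `α < ω₁`. -/
def IsClusterPointOfSeq {Y : Type*} [TopologicalSpace Y]
    (x : Iio (ω₁ : Ordinal.{0}) → Y) (z : Y) : Prop :=
  ∀ U ∈ 𝓝 z, {α | x α ∈ U}.Infinite

/-- The space `K` is `n`-diverse (a notion used for compact Hausdorff `K`): for each `m` and each
partition of the `m` coordinates into at most `n` pieces, every `ω₁`-sequence of diverse points of
`K ^ m` has a diverse cluster point in `K ^ m` (with the product topology). -/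
def IsDiverseSpace (K : Type*) [TopologicalSpace K] (n : ℕ) : Prop :=
  ∀ (m k : ℕ) (F : Fin k → Set (Fin m)), k ≤ n → IsPartition F →
    ∀ x : Iio (ω₁ : Ordinal.{0}) → (Fin m → K), (∀ α, IsDiversePoint F (x α)) →
      ∃ z : Fin m → K, IsDiversePoint F z ∧ IsClusterPointOfSeq x z

/-- A space is scattered if each nonempty subset has a relatively isolated point. -/
def IsScatteredSpace (K : Type*) [TopologicalSpace K] : Prop :=
  ∀ s : Set K, s.Nonempty → ∃ x ∈ s, ∃ U : Set K, IsOpen U ∧ U ∩ s = {x}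

/-- The ordinal `a` is the (Cantor–Bendixson) height of `K`: the least ordinal whose
Cantor–Bendixson derivative of `K` is empty. -/
def HasHeight (K : Type*) [TopologicalSpace K] (a : Ordinal) : Prop :=
  IsLeast {b | (univ : Set K)ᵈ[b] = ∅} a

/-- The weight of a space: the least cardinality of a base of its topology. -/
noncomputable def topWeight (K : Type*) [TopologicalSpace K] : Cardinal :=
  sInf {κ | ∃ B : Set (Set K), TopologicalSpace.IsTopologicalBasis B ∧ #B = κ}

/-!
The points are the countable ordinals, split into finite blocks by a map `collapse n` whose fibre
over a limit ordinal `q` is `{q, …, q + (n - 1)}`. A set guessed by `♣` at `q` is read, through a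
coding of finite sets of labelled points, as a sequence of finite labelled sets converging to `q`.
The points carrying label `i < n` are made to converge to `q + i`; the points carrying any other
label are kept away from the whole block, so that they converge to the point `ω₁` at infinity.
Points over which nothing useful is guessed are isolated, and the space is the one-point
compactification of the resulting locally compact space.

The construction is axiomatised as a `FanSystem`: each point `x` has a *fan* of points below it
which converge to it. The neighbourhood `cone x` of `x` consists of everything reached from `x` by
descending along fans, where a step from `x` to `y` may continue only to points lying, with respect
to the projection, above every mark below `y`. Cones over distinct points of one block are
disjoint (`disjoint_cone`), open and compact, and the projection to the ordinals is continuous. This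
gives a locally compact Hausdorff space.

To control the height, each code also carries a natural number, which bounds the ranks of the
labelled points; so the rank of a limit point is announced by the guess itself, and no recursion is
needed. A point of rank `m` leaves the iterated derived sets after at most `m + 1` steps, whereas
guessing sets of single points shows that all finite derived sets meet every final segment.

Everything else rests on `guesses_guessSystem`: if a family of finite labelled sets contains members
lying above any given countable ordinal, some limit `q` guesses an infinite part of it. For
`(n + 1)`-diversity (`isDiverseSpace_of_guesses`), pass to an uncountable set of indices on which as
many coordinates as possible are constant; the remaining coordinates then take values above any
given countable ordinal. There are at most `n + 1` pieces, and at most one of them has a coordinate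
constantly equal to `ω₁`; that piece receives the label `n`, which converges to `ω₁`, and the others
receive distinct labels, so their coordinates converge to distinct points of the block over `q`.
-/

/-! ### Fan systems and their topology -/

/-- Points `X` projected to a linear order `Y`, each with a fan of points that will converge to it.
`marks q` contains the fans of all points over `q`, and possibly further points, which are to be
separated from the points over `q`; it is finite below each `β < q`. The rank decreases along fans,
which bounds the Cantor–Bendixson rank and replaces well-foundedness of `Y` in inductions. -/
class FanSystem (X : Type*) (Y : outParam Type*) [LinearOrder Y] where
  proj : X → Y
  fan : X → Set X
  marks : Y → Set X
  rank : X → ℕ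
  fan_subset : ∀ x, fan x ⊆ marks (proj x)
  proj_lt : ∀ {q y}, y ∈ marks q → proj y < q
  finite_le : ∀ {q β}, β < q → {y ∈ marks q | proj y ≤ β}.Finite
  disjoint_fan : ∀ {x x'}, proj x = proj x' → x ≠ x' → Disjoint (fan x) (fan x')
  rank_lt : ∀ {x y}, y ∈ fan x → rank y < rank x

namespace FanSystem

variable {X Y : Type*} [LinearOrder Y] [FanSystem X Y]

/-- `z` is reached from `x` by descending along fans. A descent from `x` through `y ∈ fan x` has to
stay, in projection, strictly above each mark that is strictly below `y`; descents through members
of the fan with different projections therefore stay over disjoint intervals. -/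
inductive MemCone : X → X → Prop
  | refl (x : X) : MemCone x x
  | step {x y z : X} (hy : y ∈ fan x) (hz : MemCone y z)
      (hcut : ∀ y' ∈ (marks (proj x) : Set X), proj y' < proj y → proj y' < proj z) :
      MemCone x z

/-- The basic neighbourhood of `x`: all points reached from `x`. -/
def cone (x : X) : Set X := {z | MemCone x z}

/-- The part of `cone x` reached by a descent through `y`, for `y ∈ fan x`. -/
def cell (x y : X) : Set X :=
  {z ∈ cone y | ∀ y' ∈ (marks (proj x) : Set X), proj y' < proj y → proj y' < proj z}

theorem mem_cone_self (x : X) : x ∈ cone x := .refl x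

theorem proj_fan_lt {x y : X} (hy : y ∈ fan x) : proj y < proj x :=
  proj_lt (fan_subset x hy)

theorem cell_subset_cone {x y : X} (hy : y ∈ fan x) : cell x y ⊆ cone x :=
  fun _ hz => MemCone.step hy hz.1 hz.2

theorem mem_cell_self (x y : X) : y ∈ cell x y := ⟨mem_cone_self y, fun _ _ h => h⟩

theorem cone_eq (x : X) : cone x = {x} ∪ ⋃ y ∈ fan x, cell x y := by
  ext z
  constructor
  · rintro (_ | ⟨hy, hz, hcut⟩)
    · exact .inl rfl
    · exact .inr (mem_biUnion hy ⟨hz, hcut⟩)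
  · rintro (rfl | hz)
    · exact mem_cone_self _
    · obtain ⟨y, hy, hz⟩ := mem_iUnion₂.1 hz
      exact cell_subset_cone hy hz

theorem proj_le_of_mem_cone {x z : X} (h : z ∈ cone x) : proj z ≤ proj x := by
  induction h with
  | refl => rfl
  | step hy _ _ ih => exact ih.trans (proj_fan_lt hy).le

theorem eq_or_proj_lt_of_mem_cone {x z : X} (h : z ∈ cone x) : z = x ∨ proj z < proj x := by
  rcases h with _ | ⟨hy, hz, _⟩
  · exact .inl rfl
  · exact .inr ((proj_le_of_mem_cone hz).trans_lt (proj_fan_lt hy))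

theorem eq_or_rank_lt_of_mem_cone {x z : X} (h : z ∈ cone x) : z = x ∨ rank z < rank x := by
  induction h with
  | refl => exact .inl rfl
  | step hy _ _ ih =>
    rcases ih with rfl | h
    · exact .inr (rank_lt hy)
    · exact .inr (h.trans (rank_lt hy))

theorem proj_eq_of_mem_cell {x y x' y' z : X} (hx : proj x = proj x') (hy : y ∈ fan x)
    (hy' : y' ∈ (marks (proj x') : Set X)) (hz : z ∈ cell x y) (hz' : z ∈ cell x' y') :
    proj y = proj y' := by
  rcases lt_trichotomy (proj y) (proj y') with h | h | h
  · exact absurd (proj_le_of_mem_cone hz.1) (hz'.2 y (hx ▸ fan_subset x hy) h).not_ge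
  · exact h
  · exact absurd (proj_le_of_mem_cone hz'.1) (hz.2 y' (hx ▸ hy') h).not_ge

/-- A common point of two cones over the same fibre lies in cells of fan members with equal
projection, so the claim descends to these members. -/
theorem disjoint_cone {x x' : X} (h : proj x = proj x') (hne : x ≠ x') :
    Disjoint (cone x) (cone x') := by
  rw [Set.disjoint_left]
  intro z hz hz'
  induction hz generalizing x' with
  | refl x =>
    rcases eq_or_proj_lt_of_mem_cone hz' with h' | h'
    · exact hne h'
    · exact h'.ne h
  | @step x y z hy hz hcut ih =>
    rcases hz' with _ | ⟨hy', hz', hcut'⟩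
    · exact ((proj_le_of_mem_cone hz).trans_lt (proj_fan_lt hy)).ne h.symm
    · refine ih (proj_eq_of_mem_cell h hy (fan_subset _ hy') ⟨hz, hcut⟩ ⟨hz', hcut'⟩) ?_ hz'
      rintro rfl
      exact Set.disjoint_left.1 (disjoint_fan h hne) hy hy'

theorem notMem_cone_of_mem_marks {x y : X} (hy : y ∈ (marks (proj x) : Set X)) (hyx : y ∉ fan x) :
    y ∉ cone x := by
  rintro (_ | ⟨hy', hz, hcut⟩)
  · exact (proj_lt hy).ne rfl
  · rcases eq_or_proj_lt_of_mem_cone hz with rfl | h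
    · exact hyx hy'
    · exact (hcut y hy h).ne rfl

variable (X) in
/-- A set is open if it contains almost all cells of each of its points. This is not an instance, as
`X` will be a set of ordinals, which has its order topology. -/
@[reducible]
def topology : TopologicalSpace X where
  IsOpen U := ∀ x ∈ U, {y ∈ fan x | ¬ cell x y ⊆ U}.Finite
  isOpen_univ := fun x _ => by simp
  isOpen_inter U V hU hV x hx := by
    refine ((hU x hx.1).union (hV x hx.2)).subset ?_
    rintro y ⟨hy, h⟩
    by_cases h' : cell x y ⊆ U
    · exact .inr ⟨hy, fun h'' => h (subset_inter h' h'')⟩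
    · exact .inl ⟨hy, h'⟩
  isOpen_sUnion s hs x := by
    rintro ⟨U, hU, hx⟩
    refine (hs U hU x hx).subset ?_
    rintro y ⟨hy, h⟩
    exact ⟨hy, fun h' => h (h'.trans (subset_sUnion_of_mem hU))⟩

attribute [local instance] topology

theorem isOpen_iff {U : Set X} :
    IsOpen U ↔ ∀ x ∈ U, {y ∈ fan x | ¬ cell x y ⊆ U}.Finite := Iff.rfl

theorem isOpen_proj_le (β : Y) : IsOpen {x : X | proj x ≤ β} := by
  refine isOpen_iff.2 fun x hx => ?_
  convert Set.finite_empty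
  refine eq_empty_of_forall_notMem fun y hy => hy.2 fun z hz => ?_
  exact (proj_le_of_mem_cone (cell_subset_cone hy.1 hz)).trans hx

theorem isOpen_proj_lt (β : Y) : IsOpen {x : X | proj x < β} := by
  refine isOpen_iff.2 fun x hx => ?_
  convert Set.finite_empty
  refine eq_empty_of_forall_notMem fun y hy => hy.2 fun z hz => ?_
  exact (proj_le_of_mem_cone (cell_subset_cone hy.1 hz)).trans_lt hx

theorem isOpen_lt_proj (β : Y) : IsOpen {x : X | β < proj x} := by
  refine isOpen_iff.2 fun x (hx : β < proj x) => ?_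
  by_cases h : ∃ y' ∈ (marks (proj x) : Set X), β ≤ proj y'
  -- Above a mark `y'` over or beyond `β`, the cells are cut off at `proj y'`.
  · obtain ⟨y', hy', hβ⟩ := h
    refine (finite_le (proj_lt hy')).subset ?_
    rintro y ⟨hy, hn⟩
    refine ⟨fan_subset x hy, le_of_not_gt fun hlt => hn fun z hz => ?_⟩
    exact hβ.trans_lt (hz.2 y' hy' hlt)
  · push Not at h
    refine (finite_le hx).subset ?_
    rintro y ⟨hy, hn⟩
    exact ⟨fan_subset x hy, (h y (fan_subset x hy)).le⟩

theorem isClosed_lt_proj (β : Y) : IsClosed {x : X | β < proj x} := by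
  rw [← isOpen_compl_iff]
  simpa [compl_ofPred] using isOpen_proj_le β

theorem isOpen_cell_of_isOpen_cone {x y : X} (hy : y ∈ fan x)
    (h : IsOpen (cone y)) : IsOpen (cell x y) := by
  have hfin : {y' ∈ (marks (proj x) : Set X) | proj y' < proj y}.Finite :=
    (finite_le (proj_fan_lt hy)).subset fun y' hy' => ⟨hy'.1, hy'.2.le⟩
  have h2 := hfin.isOpen_biInter (f := fun y' => {z : X | proj y' < proj z})
    fun y' _ => isOpen_lt_proj _
  convert h.inter h2 using 1
  ext z
  simp [cell, and_imp]

theorem isOpen_cone (x : X) : IsOpen (cone x) := by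
  induction hr : rank x using Nat.strong_induction_on generalizing x with
  | _ r ih =>
    refine isOpen_iff.2 fun z hz => ?_
    rcases (cone_eq x ▸ hz : z ∈ {x} ∪ ⋃ y ∈ fan x, cell x y) with rfl | hz
    · convert Set.finite_empty
      exact eq_empty_of_forall_notMem fun y hy => hy.2 (cell_subset_cone hy.1)
    · obtain ⟨y, hy, hz⟩ := mem_iUnion₂.1 hz
      have := isOpen_cell_of_isOpen_cone hy (ih _ (hr ▸ rank_lt hy) y rfl)
      refine (isOpen_iff.1 this z hz).subset ?_
      rintro w ⟨hw, h⟩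
      exact ⟨hw, fun h' => h (h'.trans (cell_subset_cone hy))⟩

theorem isCompact_cone (x : X) : IsCompact (cone x) := by
  induction hr : rank x using Nat.strong_induction_on generalizing x with
  | _ r ih =>
    have hcell : ∀ y ∈ fan x, IsCompact (cell x y) := by
      intro y hy
      have h2 : IsClosed (⋂ y' ∈ {y' ∈ (marks (proj x) : Set X) | proj y' < proj y},
          {z : X | proj y' < proj z}) :=
        isClosed_biInter fun y' _ => isClosed_lt_proj _
      convert (ih _ (hr ▸ rank_lt hy) y rfl).inter_right h2 using 1
      ext z
      simp [cell, and_imp]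
    refine isCompact_of_finite_subcover fun {ι} U hU hcov => ?_
    -- The member of the cover containing `x` contains all but finitely many cells.
    obtain ⟨i, hi⟩ := mem_iUnion.1 (hcov (mem_cone_self x))
    have hfin := isOpen_iff.1 (hU i) x hi
    have hK := hfin.isCompact_biUnion (f := fun y => (cell x y : Set X))
      fun y hy => hcell y hy.1
    obtain ⟨t, ht⟩ := hK.elim_finite_subcover U hU
      ((iUnion₂_subset fun y hy => cell_subset_cone hy.1).trans hcov)
    classical
    refine ⟨insert i t, ?_⟩
    rw [cone_eq, Finset.set_biUnion_insert]
    refine union_subset (singleton_subset_iff.2 (.inl hi)) (iUnion₂_subset fun y hy => ?_)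
    by_cases h : cell x y ⊆ U i
    · exact h.trans subset_union_left
    · exact (subset_biUnion_of_mem (u := fun y => cell x y)
        (show y ∈ {y ∈ fan x | ¬ cell x y ⊆ U i} from ⟨hy, h⟩)).trans
          (ht.trans subset_union_right)

theorem t2Space : T2Space X := by
  refine ⟨fun x x' hne => ?_⟩
  rcases lt_trichotomy (proj x) (proj x') with h | h | h
  · exact ⟨_, _, isOpen_proj_le (proj x), isOpen_lt_proj (proj x), le_refl _, h,
      Set.disjoint_left.2 fun z (hz : _ ≤ _) hz' => hz.not_gt hz'⟩
  · exact ⟨_, _, isOpen_cone x, isOpen_cone x', mem_cone_self x, mem_cone_self x',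
      disjoint_cone h hne⟩
  · exact ⟨_, _, isOpen_lt_proj (proj x'), isOpen_proj_le (proj x'), h, le_refl _,
      Set.disjoint_left.2 fun z hz (hz' : _ ≤ _) => hz'.not_gt hz⟩

theorem locallyCompactSpace : LocallyCompactSpace X := by
  have := t2Space (X := X)
  have : WeaklyLocallyCompactSpace X :=
    ⟨fun x => ⟨_, isCompact_cone x, (isOpen_cone x).mem_nhds (mem_cone_self x)⟩⟩
  infer_instance

theorem continuous_proj [TopologicalSpace Y] [OrderTopology Y] :
    Continuous (fun x : X => proj x) := by
  rw [OrderTopology.topology_eq_generate_intervals (α := Y), continuous_generateFrom_iff]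
  rintro s ⟨β, rfl | rfl⟩
  · exact isOpen_lt_proj β
  · exact isOpen_proj_lt β

theorem finite_fan_diff_of_mem_nhds {x : X} {U : Set X} (hU : U ∈ 𝓝 (x : X)) :
    (fan x \ U).Finite := by
  obtain ⟨V, hVU, hV, hx⟩ := mem_nhds_iff.1 hU
  refine (isOpen_iff.1 hV x hx).subset ?_
  rintro y ⟨hy, hyU⟩
  exact ⟨hy, fun h => hyU (hVU (h (mem_cell_self x y)))⟩

/-- Marks over `q` that belong to no fan over `q` form a closed discrete set, and hence converge to
infinity. -/
theorem finite_inter_of_isCompact {q : Y} {E : Set X} (hE : E ⊆ (marks q : Set X))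
    (hfan : ∀ x, proj x = q → Disjoint E (fan x)) {C : Set X} (hC : IsCompact C) :
    (C ∩ E).Finite := by
  refine hC.induction_on (p := fun s => (s ∩ E).Finite) (by simp)
    (fun s t hst ht => ht.subset (inter_subset_inter_left _ hst))
    (fun s t hs ht => by simpa only [union_inter_distrib_right] using hs.union ht)
    fun x _ => ?_
  rcases lt_trichotomy (proj x) q with h | h | h
  · refine ⟨_, mem_nhdsWithin_of_mem_nhds ((isOpen_proj_le (proj x)).mem_nhds (le_refl _)), ?_⟩
    exact (finite_le h).subset fun y hy => ⟨hE hy.2, hy.1⟩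
  · refine ⟨_, mem_nhdsWithin_of_mem_nhds ((isOpen_cone x).mem_nhds (mem_cone_self x)), ?_⟩
    convert Set.finite_empty
    refine eq_empty_of_forall_notMem fun y hy => ?_
    exact notMem_cone_of_mem_marks (h ▸ hE hy.2) (Set.disjoint_left.1 (hfan x h) hy.2) hy.1
  · refine ⟨_, mem_nhdsWithin_of_mem_nhds ((isOpen_lt_proj q).mem_nhds h), ?_⟩
    convert Set.finite_empty
    exact eq_empty_of_forall_notMem fun y hy => (proj_lt (hE hy.2)).not_gt hy.1

end FanSystem

/-! ### Countable ordinals and weight -/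

/-- The countable ordinals, as a linear order. -/
abbrev CountableOrdinal : Type 1 := Iio (ω₁ : Ordinal.{0})

theorem countable_Iic_of_lt_omega_one (β : CountableOrdinal) : (Iic β).Countable := by
  have hβ : Order.succ (β : Ordinal.{0}) < ω₁ := (Cardinal.isSuccLimit_omega 1).succ_lt β.2
  have h : (Iio (Order.succ (β : Ordinal.{0}))).Countable := by
    rw [← Cardinal.le_aleph0_iff_set_countable, Cardinal.mk_Iio_ordinal, Cardinal.lift_le_aleph0,
      ← not_lt, ← Cardinal.aleph_one_le_iff, not_le]
    exact Cardinal.lt_omega_iff_card_lt.1 hβ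
  exact (h.preimage Subtype.val_injective).mono fun x hx =>
    Order.lt_succ_of_le (show (x : Ordinal.{0}) ≤ β from hx)

theorem exists_forall_lt_of_countable {s : Set CountableOrdinal} (hs : s.Countable) :
    ∃ β, ∀ α ∈ s, α < β := by
  have := hs.to_subtype
  have h : ⨆ a : s, Order.succ ((a : CountableOrdinal) : Ordinal.{0}) < ω₁ :=
    Ordinal.iSup_lt_omega_one fun a =>
      (Cardinal.isSuccLimit_omega 1).succ_lt a.1.2
  refine ⟨⟨_, h⟩, fun α hα => ?_⟩
  exact (Order.lt_succ (α : Ordinal.{0})).trans_le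
    (le_ciSup (f := fun a : s => Order.succ ((a : CountableOrdinal) : Ordinal.{0}))
      Ordinal.bddAbove_of_small ⟨α, hα⟩)

/-- Separating each pair of points by two open sets gives a family of `#K` open sets that generates
a Hausdorff topology coarser than the compact one, hence equal to it. -/
theorem topWeight_eq_aleph_one {K : Type*} [TopologicalSpace K] [CompactSpace K] [T2Space K]
    (hK : #K ≤ ℵ₁) (hsep : ¬ TopologicalSpace.SeparableSpace K) : topWeight K = ℵ₁ := by
  classical
  have hinf : Infinite K := by
    by_contra h
    rw [not_infinite_iff_finite] at h
    exact hsep inferInstance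
  have hmin : ∀ B : Set (Set K), TopologicalSpace.IsTopologicalBasis B → ℵ₁ ≤ #B := by
    intro B hB
    rw [Cardinal.aleph_one_le_iff, ← not_le, Cardinal.le_aleph0_iff_set_countable]
    intro hc
    have := hB.secondCountableTopology hc
    exact hsep inferInstance
  have hne : {κ | ∃ B : Set (Set K), TopologicalSpace.IsTopologicalBasis B ∧ #B = κ}.Nonempty :=
    ⟨_, _, TopologicalSpace.isTopologicalBasis_opens, rfl⟩
  refine le_antisymm ?_ ?_
  swap
  · obtain ⟨B, hB, hκ⟩ := csInf_mem hne
    exact (hmin B hB).trans_eq hκ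
  choose! u hu using fun (p : K × K) (h : p.1 ≠ p.2) => t2_separation h
  choose! v hu hv hxu hyv huv using hu
  let s : Set (Set K) := range (fun p : {p : K × K // p.1 ≠ p.2} => u p) ∪
    range (fun p : {p : K × K // p.1 ≠ p.2} => v p)
  have hs : #s ≤ #K := by
    have h1 : #{p : K × K // p.1 ≠ p.2} ≤ #K :=
      (Cardinal.mk_subtype_le _).trans
        (by simp [Cardinal.mul_eq_self (Cardinal.infinite_iff.1 hinf)])
    calc #s ≤ #K + #K := (Cardinal.mk_union_le _ _).trans
          (add_le_add (Cardinal.mk_range_le.trans h1) (Cardinal.mk_range_le.trans h1))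
      _ = #K := Cardinal.add_eq_self (Cardinal.infinite_iff.1 hinf)
  have hgen : (inferInstance : TopologicalSpace K) = TopologicalSpace.generateFrom s := by
    have hle : (inferInstance : TopologicalSpace K) ≤ TopologicalSpace.generateFrom s := by
      refine le_generateFrom ?_
      rintro _ (⟨p, rfl⟩ | ⟨p, rfl⟩)
      · exact hu _ p.2
      · exact hv _ p.2
    have hT2 : @T2Space K (TopologicalSpace.generateFrom s) := by
      refine @T2Space.mk K (TopologicalSpace.generateFrom s) fun x y hxy => ?_
      exact ⟨u (x, y), v (x, y),
        TopologicalSpace.isOpen_generateFrom_of_mem (.inl ⟨⟨(x, y), hxy⟩, rfl⟩),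
        TopologicalSpace.isOpen_generateFrom_of_mem (.inr ⟨⟨(x, y), hxy⟩, rfl⟩),
        hxu _ hxy, hyv _ hxy, huv _ hxy⟩
    refine le_antisymm hle ?_
    have hc := @Continuous.continuous_symm_of_equiv_compact_to_t2 K K _
      (TopologicalSpace.generateFrom s) _ hT2 (Equiv.refl K) (continuous_id_iff_le.2 hle)
    exact continuous_id_iff_le.1 hc
  have hB := TopologicalSpace.isTopologicalBasis_of_subbasis hgen
  have hle : topWeight K ≤ #((fun f => ⋂₀ f) '' {f : Set (Set K) | f.Finite ∧ f ⊆ s}) :=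
    csInf_le' ⟨_, hB, rfl⟩
  refine hle.trans ?_
  have hsub : (fun f => ⋂₀ f) '' {f : Set (Set K) | f.Finite ∧ f ⊆ s} ⊆
      range fun t : Finset s => ⋂₀ (Subtype.val '' (t : Set s)) := by
    rintro _ ⟨f, ⟨hf, hfs⟩, rfl⟩
    refine ⟨(hf.preimage Subtype.val_injective.injOn).toFinset, ?_⟩
    simp [Subtype.image_preimage_coe, inter_eq_right.2 hfs]
  refine (Cardinal.mk_le_mk_of_subset hsub).trans (Cardinal.mk_range_le.trans ?_)
  rcases finite_or_infinite s with h | h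
  · exact (Cardinal.mk_le_aleph0).trans (Cardinal.aleph0_le_aleph 1)
  · rw [Cardinal.mk_finset_of_infinite]
    exact hs.trans hK

/-! ### Guessing and topological consequences -/

namespace FanSystem

variable {X : Type*} [FanSystem X CountableOrdinal]

/-- `q` guesses the members of the family `d` of finite sets of labelled points with index in `T`:
the fibre over `q` is `{p i | i < n}`, the fan of `p i` consists of the points labelled `i`, and all
labelled points are marks over `q`. -/
structure IsGuess (n : ℕ) (d : CountableOrdinal → Finset (X × ℕ))
    (q : CountableOrdinal) (T : Set CountableOrdinal) (p : ℕ → X) : Prop where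
  infinite : T.Infinite
  finite_le : ∀ γ < q, {α ∈ T | ∃ e ∈ d α, proj e.1 ≤ γ}.Finite
  marks_eq : (marks q : Set X) = {y | ∃ α ∈ T, ∃ i, (y, i) ∈ d α}
  injOn : InjOn p (Iio n)
  proj_eq : ∀ i < n, proj (p i) = q
  exists_eq : ∀ x, proj x = q → ∃ i < n, x = p i
  label_unique : ∀ α ∈ T, ∀ α' ∈ T, ∀ y i i', (y, i) ∈ d α → (y, i') ∈ d α' → i = i'
  fan_eq : ∀ i < n, fan (p i) = {y | ∃ α ∈ T, (y, i) ∈ d α}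

variable (X) in
/-- Each family of finite labelled sets having, with index in `A`, members that lie above any given
countable ordinal is guessed by arbitrarily large countable ordinals. -/
def Guesses (n : ℕ) : Prop :=
  ∀ (A : Set CountableOrdinal) (d : CountableOrdinal → Finset (X × ℕ)),
    (∀ α y i i', (y, i) ∈ d α → (y, i') ∈ d α → i = i') →
    (∀ β, ∃ α ∈ A, β < α ∧ ∀ e ∈ d α, β < proj e.1) →
    ∀ β, ∃ q > β, ∃ T ⊆ A, ∃ p, IsGuess n d q T p

theorem IsGuess.finite_of_finite {n : ℕ} {d : CountableOrdinal → Finset (X × ℕ)}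
    {q : CountableOrdinal} {T : Set CountableOrdinal} {p : ℕ → X}
    (h : IsGuess n d q T p) {E : Set X} (hE : E.Finite) :
    {α ∈ T | ∃ e ∈ d α, e.1 ∈ E}.Finite := by
  refine ((hE.inter_of_left (marks q)).biUnion fun y hy =>
    h.finite_le (proj y) (proj_lt hy.2)).subset ?_
  rintro α ⟨hα, e, he, heE⟩
  refine mem_biUnion (x := e.1) ⟨heE, ?_⟩ ⟨hα, e, he, le_rfl⟩
  rw [h.marks_eq]
  exact ⟨α, hα, e.2, he⟩

attribute [local instance] topology

variable {K : Type*} [TopologicalSpace K] {j : X → K} {pt : K}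

theorem isScatteredSpace_of_range (hj : IsOpenEmbedding j) (hr : range j = {pt}ᶜ) :
    IsScatteredSpace K := by
  intro s hs
  by_cases h : (j ⁻¹' s).Nonempty
  · obtain ⟨x, hx, hmin⟩ := exists_minimalFor_of_wellFoundedLT (fun x => x ∈ j ⁻¹' s) rank h
    refine ⟨j x, hx, j '' cone x, hj.isOpenMap _ (isOpen_cone x), ?_⟩
    refine subset_antisymm ?_ (singleton_subset_iff.2 ⟨mem_image_of_mem j (mem_cone_self x), hx⟩)
    rintro _ ⟨⟨z, hz, rfl⟩, hzs⟩
    rcases eq_or_rank_lt_of_mem_cone hz with rfl | hlt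
    · rfl
    · exact absurd (hmin hzs hlt.le) hlt.not_ge
  · have hpt : ∀ y ∈ s, y = pt := by
      intro y hy
      by_contra hne
      obtain ⟨x, rfl⟩ := (hr ▸ hne : y ∈ range j)
      exact h ⟨x, hy⟩
    obtain ⟨y, hy⟩ := hs
    exact ⟨y, hy, univ, isOpen_univ, by
      rw [univ_inter]
      exact eq_singleton_iff_unique_mem.2 ⟨hy, fun z hz => (hpt z hz).trans (hpt y hy).symm⟩⟩

theorem exists_lt_proj {n : ℕ} (hn : 1 ≤ n) (hg : Guesses X n) (β : CountableOrdinal) :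
    ∃ x : X, β < proj x := by
  obtain ⟨q, hq, T, -, p, hp⟩ := hg univ (fun _ => ∅) (by simp) (fun β => by
    obtain ⟨α, hα⟩ := exists_forall_lt_of_countable (countable_singleton β)
    exact ⟨α, mem_univ _, hα β rfl, by simp⟩) β
  exact ⟨p 0, (hp.proj_eq 0 hn).symm ▸ hq⟩

theorem not_separableSpace_of_guesses {n : ℕ} (hn : 1 ≤ n) (hg : Guesses X n)
    (hj : IsOpenEmbedding j) : ¬ TopologicalSpace.SeparableSpace K := by
  rintro ⟨s, hs, hd⟩
  obtain ⟨β, hβ⟩ := exists_forall_lt_of_countable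
    ((hs.preimage hj.injective).image (proj : X → CountableOrdinal))
  obtain ⟨x, hx⟩ := exists_lt_proj hn hg β
  obtain ⟨_, hys, y, hy, rfl⟩ := hd.exists_mem_open (hj.isOpenMap _ (isOpen_lt_proj β))
    ⟨_, mem_image_of_mem j hx⟩
  exact (hβ _ (mem_image_of_mem _ hys)).not_gt hy

theorem le_rank_of_mem_iteratedDerivedSet (hj : IsOpenEmbedding j) (m : ℕ) (x : X)
    (hx : j x ∈ (univ : Set K)ᵈ[(m : Ordinal)]) : m ≤ rank x := by
  induction m generalizing x with
  | zero => exact Nat.zero_le _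
  | succ m ih =>
    rw [Nat.cast_succ, iteratedDerivedSet_succ, relDerivedSet_apply] at hx
    obtain ⟨_, ⟨⟨z, hz, rfl⟩, hzm⟩, hne⟩ := accPt_iff_nhds.1 (mem_derivedSet.1 hx.1) _
      ((hj.isOpenMap _ (isOpen_cone x)).mem_nhds (mem_image_of_mem j (mem_cone_self x)))
    rcases eq_or_rank_lt_of_mem_cone hz with rfl | h
    · exact absurd rfl hne
    · exact (ih z hzm).trans_lt h

/-- If the `m`-th derived set meets each final segment, one of its points can be chosen above each
countable ordinal, and any guess of these points is a fan converging to a point of the next derived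
set. -/
theorem exists_mem_iteratedDerivedSet {n : ℕ} (hn : 1 ≤ n) (hg : Guesses X n)
    (hj : IsOpenEmbedding j) (m : ℕ) (β : CountableOrdinal) :
    ∃ x : X, β < proj x ∧ j x ∈ (univ : Set K)ᵈ[(m : Ordinal)] := by
  induction m generalizing β with
  | zero => simpa using exists_lt_proj hn hg β
  | succ m ih =>
    choose f hf hfm using ih
    obtain ⟨q, hq, T, -, p, hp⟩ := hg univ (fun α => {(f α, 0)}) (by
      intro α y i i' h h'
      rw [Finset.mem_singleton, Prod.mk.injEq] at h h'
      exact h.2.trans h'.2.symm) (fun β => by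
      obtain ⟨α, hα⟩ := exists_forall_lt_of_countable (countable_singleton β)
      refine ⟨α, mem_univ _, hα β rfl, ?_⟩
      simpa using (hα β rfl).trans (hf α)) β
    refine ⟨p 0, (hp.proj_eq 0 hn).symm ▸ hq, ?_⟩
    rw [Nat.cast_succ, iteratedDerivedSet_succ,
      (isClosed_iteratedDerivedSet isClosed_univ _).relDerivedSet_eq, mem_derivedSet,
      accPt_iff_nhds]
    intro U hU
    have hfin := hp.finite_of_finite
      (finite_fan_diff_of_mem_nhds (hj.continuous.continuousAt.preimage_mem_nhds hU))
    obtain ⟨α, hα, hαE⟩ := (hp.infinite.sdiff hfin).nonempty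
    have hfan : f α ∈ fan (p 0) := by
      rw [hp.fan_eq 0 hn]
      exact ⟨α, hα, by simp⟩
    refine ⟨j (f α), ⟨?_, hfm α⟩, fun h => ?_⟩
    · by_contra hU
      exact hαE ⟨hα, _, Finset.mem_singleton_self _, hfan, hU⟩
    · rw [hj.injective h] at hfan
      exact (proj_fan_lt hfan).ne rfl

theorem hasHeight_of_guesses [CompactSpace K] {n : ℕ} (hn : 1 ≤ n) (hg : Guesses X n)
    (hj : IsOpenEmbedding j) (hr : range j = {pt}ᶜ) : HasHeight K (ω + 1) := by
  have hcl := fun a : Ordinal => isClosed_iteratedDerivedSet (isClosed_univ (X := K)) a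
  constructor
  · have hsub : (univ : Set K)ᵈ[ω] ⊆ {pt} := by
      intro y hy
      by_contra hne
      obtain ⟨x, rfl⟩ := (hr ▸ hne : y ∈ range j)
      have := le_rank_of_mem_iteratedDerivedSet hj (rank x + 1) x
        (iteratedDerivedSet_antitone _ (Ordinal.natCast_lt_omega0 _).le hy)
      omega
    refine eq_empty_of_forall_notMem fun y hy => ?_
    rw [iteratedDerivedSet_succ, relDerivedSet_apply] at hy
    obtain ⟨z, hz, hne⟩ := accPt_iff_nhds.1 (mem_derivedSet.1 hy.1) univ Filter.univ_mem
    exact hne ((hsub hz.2).trans (hsub hy.2).symm)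
  · intro b hb
    by_contra hlt
    rw [not_le, Order.lt_add_one_iff] at hlt
    have hemp : (univ : Set K)ᵈ[ω] = ∅ :=
      subset_empty_iff.1 ((iteratedDerivedSet_antitone _ hlt).trans_eq hb)
    obtain ⟨y, hy⟩ := IsCompact.nonempty_iInter_of_sequence_nonempty_isCompact_isClosed
      (fun m : ℕ => (univ : Set K)ᵈ[(m : Ordinal)])
      (fun m => iteratedDerivedSet_antitone _ (by simp))
      (fun m => by
        obtain ⟨x, -, hx⟩ := exists_mem_iteratedDerivedSet hn hg hj m ⟨0, Ordinal.omega_pos 1⟩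
        exact ⟨_, hx⟩)
      (hcl _).isCompact (fun m => hcl _)
    refine (hemp ▸ ?_ : y ∈ (∅ : Set K))
    rw [iteratedDerivedSet_limit Ordinal.isSuccLimit_omega0]
    refine mem_iInter.2 fun b => ?_
    obtain ⟨m, hm⟩ := Ordinal.lt_omega0.1 b.2
    rw [hm]
    exact mem_iInter.1 hy m

end FanSystem

/-! ### Diversity -/

/-- After fixing as many coordinates as possible on an uncountable set of indices, each further
coordinate takes each value only countably often. -/
theorem exists_maximal_constant_coordinates {ι K : Type*} {m : ℕ} (x : ι → Fin m → K)
    (hι : ¬ (univ : Set ι).Countable) :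
    ∃ (I : Finset (Fin m)) (c : Fin m → K), ¬ {α | ∀ i ∈ I, x α i = c i}.Countable ∧
      ∀ i ∉ I, ∀ v, {α | (∀ i ∈ I, x α i = c i) ∧ x α i = v}.Countable := by
  classical
  have hne : {I : Finset (Fin m) | ∃ c : Fin m → K,
      ¬ {α | ∀ i ∈ I, x α i = c i}.Countable}.Nonempty := by
    obtain ⟨α, -⟩ : (univ : Set ι).Nonempty := by
      rw [nonempty_iff_ne_empty]
      rintro h
      exact hι (h ▸ countable_empty)
    exact ⟨∅, x α, by simpa using hι⟩
  obtain ⟨I, ⟨c, hc⟩, hmax⟩ := (toFinite _).exists_maximal hne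
  refine ⟨I, c, hc, fun i hi v => ?_⟩
  by_contra hcon
  refine hi (hmax (y := insert i I) ⟨Function.update c i v, fun h => hcon (h.mono ?_)⟩
    (Finset.subset_insert i I) (Finset.mem_insert_self i I))
  rintro α ⟨h1, h2⟩ i' hi'
  rcases eq_or_ne i' i with rfl | hne'
  · simpa using h2
  · rw [Function.update_of_ne hne']
    exact h1 i' (Finset.mem_of_mem_insert_of_ne hi' hne')

/-- At most `n + 1` pieces can be labelled injectively by `0, …, n` so that a piece distinguished by
`P`, if there is one, gets the label `n`. -/
theorem exists_injective_label {k n : ℕ} (hk : k ≤ n + 1) (P : Fin k → Prop)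
    (hP : ∀ a b, P a → P b → a = b) :
    ∃ σ : Fin k → ℕ, Function.Injective σ ∧ (∀ a, σ a ≤ n) ∧ ∀ a, P a → σ a = n := by
  by_cases h : ∃ a, P a
  · obtain ⟨a, ha⟩ := h
    refine ⟨fun b => Equiv.swap (Fin.castLE hk a) (Fin.last n) (Fin.castLE hk b), ?_, ?_, ?_⟩
    · exact Fin.val_injective.comp ((Equiv.injective _).comp (Fin.castLE_injective hk))
    · exact fun b => Nat.lt_succ_iff.1 (Fin.is_lt _)
    · intro b hb
      simp [hP b a hb ha]
  · exact ⟨fun b => b, Fin.val_injective, fun b => Nat.lt_succ_iff.1 (b.2.trans_le hk),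
      fun b hb => absurd ⟨b, hb⟩ h⟩

namespace FanSystem

variable {X : Type*} [FanSystem X CountableOrdinal]

attribute [local instance] topology

variable {K : Type*} [TopologicalSpace K] {j : X → K} {pt : K}

theorem isCompact_preimage_compl_of_mem_nhds [CompactSpace K] (hj : IsOpenEmbedding j)
    (hr : range j = {pt}ᶜ) {U : Set K} (hU : U ∈ 𝓝 pt) : IsCompact (j ⁻¹' (interior U)ᶜ) := by
  refine (hj.isInducing.isCompact_preimage_iff ?_).2 isOpen_interior.isClosed_compl.isCompact
  rw [hr, compl_subset_compl, singleton_subset_iff]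
  exact mem_interior_iff_mem_nhds.2 hU

theorem isDiverseSpace_of_guesses [CompactSpace K] {n : ℕ} (hn : 1 ≤ n) (hg : Guesses X n)
    (hj : IsOpenEmbedding j) (hr : range j = {pt}ᶜ)
    (hcount : ∀ β : CountableOrdinal, {x : X | proj x ≤ β}.Countable) :
    IsDiverseSpace K (n + 1) := by
  classical
  intro m k F hk hF x hx
  obtain ⟨x₀, -⟩ := exists_lt_proj hn hg ⟨0, Ordinal.omega_pos 1⟩
  have : Nonempty X := ⟨x₀⟩
  have hjpt : ∀ y, j y ≠ pt := fun y => by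
    have : j y ∈ range j := mem_range_self y
    rwa [hr] at this
  -- `g` inverts `j`, `b i` is the piece containing the coordinate `i`.
  let g : K → X := Function.invFun j
  have hjg : ∀ v, v ≠ pt → j (g v) = v := fun v hv =>
    Function.invFun_eq (show v ∈ range j from hr ▸ hv)
  have hgj : ∀ y, g (j y) = y := Function.leftInverse_invFun hj.injective
  have hb : ∀ i, ∃ b, i ∈ F b := fun i => mem_iUnion.1 (hF.2 ▸ mem_univ i)
  choose b hb using hb
  have hbu : ∀ i a, i ∈ F a → a = b i := fun i a hi => by
    by_contra h
    exact Set.disjoint_left.1 (hF.1 h) hi (hb i)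
  have hsep : ∀ α i i', x α i = x α i' → b i = b i' := fun α i i' h => by
    by_contra hne
    refine Set.disjoint_left.1 (hx α (b i)) (mem_image_of_mem _ (hb i)) ?_
    exact ⟨i', fun hi' => hne (hbu i' _ hi'), h.symm⟩
  obtain ⟨I, c, hI, hmax⟩ := exists_maximal_constant_coordinates x (fun h => by
    obtain ⟨β, hβ⟩ := exists_forall_lt_of_countable h
    exact (hβ β (mem_univ _)).ne rfl)
  -- Indices at which the coordinates in `I` take their constant values and no other is at infinity.
  let A : Set CountableOrdinal :=
    {α | (∀ i ∈ I, x α i = c i) ∧ ∀ i ∉ I, x α i ≠ pt}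
  have hA : ∀ β, ∃ α ∈ A, β < α ∧ ∀ i ∉ I, β < proj (g (x α i)) := by
    intro β
    by_contra hcon
    refine hI (Countable.mono ?_ ((countable_Iic_of_lt_omega_one β).union
      (Set.countable_iUnion fun i : {i // i ∉ I} =>
        (((hcount β).image j).insert pt).biUnion fun v _ => hmax i i.2 v)))
    intro α hα
    by_contra hα'
    rw [mem_union, not_or, mem_Iic, not_le] at hα'
    refine hcon ⟨α, ⟨hα, fun i hi h => hα'.2 ?_⟩, hα'.1, fun i hi => ?_⟩
    · exact mem_iUnion.2 ⟨⟨i, hi⟩, mem_biUnion (mem_insert _ _) ⟨hα, h⟩⟩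
    · by_contra h
      rw [not_lt] at h
      refine hα'.2 (mem_iUnion.2 ⟨⟨i, hi⟩, mem_biUnion ?_ ⟨hα, rfl⟩⟩)
      by_cases hp : x α i = pt
      · exact .inl hp
      · exact .inr ⟨_, h, hjg _ hp⟩
  obtain ⟨α₀, hα₀, -⟩ := hA ⟨0, Ordinal.omega_pos 1⟩
  have hcsep : ∀ i ∈ I, ∀ i' ∈ I, c i = c i' → b i = b i' := fun i hi i' hi' h =>
    hsep α₀ i i' (by rw [hα₀.1 i hi, hα₀.1 i' hi', h])
  -- The piece with a coordinate constantly at infinity, if any, has to be sent to infinity.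
  obtain ⟨σ, hσ, hσn, hσpt⟩ := exists_injective_label hk (fun a => ∃ i ∈ I, c i = pt ∧ b i = a) (by
    rintro _ _ ⟨i, hi, h, rfl⟩ ⟨i', hi', h', rfl⟩
    exact hcsep i hi i' hi' (h.trans h'.symm))
  let d : CountableOrdinal → Finset (X × ℕ) := fun α =>
    (Finset.univ.filter fun i => i ∉ I ∧ x α i ≠ pt).image fun i => (g (x α i), σ (b i))
  have hd : ∀ α e, e ∈ d α ↔ ∃ i, (i ∉ I ∧ x α i ≠ pt) ∧ (g (x α i), σ (b i)) = e := by
    intro α e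
    simp [d]
  -- Guessing above `β₀` keeps the new limits away from the constant values.
  obtain ⟨β₀, hβ₀⟩ := exists_forall_lt_of_countable
    (finite_range fun i => (proj (g (c i)) : CountableOrdinal)).countable
  obtain ⟨q, hq, T, hTA, p, hp⟩ := hg A d (by
    intro α y l l' h h'
    obtain ⟨i, hi, he⟩ := (hd _ _).1 h
    obtain ⟨i', hi', he'⟩ := (hd _ _).1 h'
    simp only [Prod.mk.injEq] at he he'
    rw [← he.2, ← he'.2, hsep α i i']
    rw [← hjg _ hi.2, ← hjg _ hi'.2, he.1, he'.1]) (by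
    intro β
    obtain ⟨α, hα, hβα, h⟩ := hA β
    refine ⟨α, hα, hβα, fun e he => ?_⟩
    obtain ⟨i, hi, rfl⟩ := (hd _ _).1 he
    exact h i hi.1) β₀
  let z : Fin m → K := fun i =>
    if i ∈ I then c i else if σ (b i) < n then j (p (σ (b i))) else pt
  have hzI : ∀ i ∈ I, z i = c i := fun i hi => if_pos hi
  have hzp : ∀ i ∉ I, σ (b i) < n → z i = j (p (σ (b i))) := fun i hi h => by
    simp only [z, if_neg hi, if_pos h]
  have hzpt : ∀ i ∉ I, ¬ σ (b i) < n → z i = pt := fun i hi h => by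
    simp only [z, if_neg hi, if_neg h]
  have hσeq : ∀ i i', ¬ σ (b i) < n → ¬ σ (b i') < n → b i = b i' := fun i i' h h' =>
    hσ (by have := hσn (b i); have := hσn (b i'); omega)
  have hmix : ∀ i ∈ I, ∀ i' ∉ I, z i = z i' → b i = b i' := by
    intro i hi i' hi' h
    rw [hzI i hi] at h
    by_cases hl : σ (b i') < n
    · rw [hzp i' hi' hl] at h
      have h1 := hβ₀ _ (mem_range_self i)
      simp only [h, hgj, hp.proj_eq _ hl] at h1
      exact absurd h1 hq.le.not_gt
    · rw [hzpt i' hi' hl] at h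
      exact hσeq i i' (hσpt (b i) ⟨i, hi, h, rfl⟩).not_lt hl
  have hzsep : ∀ i i', z i = z i' → b i = b i' := by
    intro i i' h
    by_cases hi : i ∈ I <;> by_cases hi' : i' ∈ I
    · exact hcsep i hi i' hi' (by rw [← hzI i hi, ← hzI i' hi', h])
    · exact hmix i hi i' hi' h
    · exact (hmix i' hi' i hi h.symm).symm
    · by_cases hl : σ (b i) < n <;> by_cases hl' : σ (b i') < n
      · rw [hzp i hi hl, hzp i' hi' hl'] at h
        exact hσ (hp.injOn hl hl' (hj.injective h))
      · rw [hzp i hi hl, hzpt i' hi' hl'] at h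
        exact absurd h (hjpt _)
      · rw [hzpt i hi hl, hzp i' hi' hl'] at h
        exact absurd h.symm (hjpt _)
      · exact hσeq i i' hl hl'
  refine ⟨z, fun a => Set.disjoint_left.2 ?_, fun U hU => ?_⟩
  · rintro _ ⟨i, hi, rfl⟩ ⟨i', hi', h⟩
    refine hi' ?_
    rw [hbu i a hi, ← hzsep i' i h]
    exact hb i'
  rw [nhds_pi, Filter.mem_pi] at hU
  obtain ⟨J, -, t, ht, htU⟩ := hU
  have hfin : ∀ i, {α ∈ T | x α i ∉ t i}.Finite := by
    intro i
    by_cases hi : i ∈ I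
    · convert Set.finite_empty
      refine eq_empty_of_forall_notMem fun α hα => hα.2 ?_
      rw [(hTA hα.1).1 i hi, ← hzI i hi]
      exact mem_of_mem_nhds (ht i)
    have hmem : ∀ α ∈ T, (g (x α i), σ (b i)) ∈ d α := fun α hα =>
      (hd _ _).2 ⟨i, ⟨hi, (hTA hα).2 i hi⟩, rfl⟩
    by_cases hl : σ (b i) < n
    · have hti : j ⁻¹' t i ∈ 𝓝 (p (σ (b i))) :=
        hj.continuous.continuousAt.preimage_mem_nhds (hzp i hi hl ▸ ht i)
      refine (hp.finite_of_finite (finite_fan_diff_of_mem_nhds hti)).subset ?_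
      rintro α ⟨hα, hαt⟩
      refine ⟨hα, _, hmem α hα, ?_, ?_⟩
      · rw [hp.fan_eq _ hl]
        exact ⟨α, hα, hmem α hα⟩
      · rwa [mem_preimage, hjg _ ((hTA hα).2 i hi)]
    · have hC := isCompact_preimage_compl_of_mem_nhds hj hr (hzpt i hi hl ▸ ht i)
      let E : Set X := {y | ∃ α ∈ T, (y, σ (b i)) ∈ d α}
      have hE : (j ⁻¹' (interior (t i))ᶜ ∩ E).Finite := by
        refine finite_inter_of_isCompact (q := q) ?_ ?_ hC
        · rintro y ⟨α, hα, hy⟩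
          rw [hp.marks_eq]
          exact ⟨α, hα, _, hy⟩
        · rintro w hw
          obtain ⟨s, hs, rfl⟩ := hp.exists_eq w hw
          rw [hp.fan_eq s hs, Set.disjoint_left]
          rintro y ⟨α, hα, hy⟩ ⟨α', hα', hy'⟩
          have := hp.label_unique α hα α' hα' y _ _ hy hy'
          omega
      refine (hp.finite_of_finite hE).subset ?_
      rintro α ⟨hα, hαt⟩
      refine ⟨hα, _, hmem α hα, ?_, α, hα, hmem α hα⟩
      rw [mem_preimage, hjg _ ((hTA hα).2 i hi)]
      exact fun h => hαt (interior_subset h)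
  refine (hp.infinite.sdiff (finite_iUnion hfin)).mono ?_
  rintro α ⟨hα, hα'⟩
  refine htU fun i _ => ?_
  by_contra h
  exact hα' (mem_iUnion.2 ⟨i, hα, h⟩)

end FanSystem

/-! ### Collapsing ordinals and coding finite labelled sets -/

theorem not_countable_univ_Iio_omega_one :
    ¬ (univ : Set CountableOrdinal).Countable := fun h => by
  obtain ⟨β, hβ⟩ := exists_forall_lt_of_countable h
  exact (hβ β (mem_univ _)).ne rfl

/-- Transfinite recursion of length `ω₁`, for a relation that can be satisfied after countably many
steps. -/
theorem exists_transfinite_sequence {Z : Type*} (R : Z → Z → Prop)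
    (H : ∀ s : Set Z, s.Countable → ∃ z, ∀ w ∈ s, R w z) :
    ∃ h : CountableOrdinal → Z, ∀ ζ η, ζ < η → R (h ζ) (h η) := by
  have hc : ∀ (η : CountableOrdinal) (ih : ∀ ζ, ζ < η → Z),
      (range fun ζ : Iio η => ih ζ.1 ζ.2).Countable := fun η ih => by
    have := ((countable_Iic_of_lt_omega_one η).mono Iio_subset_Iic_self).to_subtype
    exact countable_range _
  let h : CountableOrdinal → Z :=
    (wellFounded_lt (α := CountableOrdinal)).fix fun η ih => (H _ (hc η ih)).choose
  refine ⟨h, fun ζ η hζ => ?_⟩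
  have heq : h η = (H _ (hc η fun ζ _ => h ζ)).choose := WellFounded.fix_eq _ _ _
  rw [heq]
  exact (H _ (hc η fun ζ _ => h ζ)).choose_spec _ ⟨⟨ζ, hζ⟩, rfl⟩

theorem sInf_le_add_le (k : ℕ) (x : Ordinal.{0}) :
    sInf {α : Ordinal.{0} | x ≤ α + (k : Ordinal.{0})} ≤ x :=
  csInf_le' (mem_ofPred.2 le_self_add)

/-- The least `α` with `x ≤ α + (n - 1)`. Over a limit ordinal `q` the fibre is
`{q, …, q + (n - 1)}`. -/
noncomputable def collapse (n : ℕ) (x : CountableOrdinal) : CountableOrdinal :=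
  ⟨sInf {α : Ordinal.{0} | (x : Ordinal.{0}) ≤ α + ((n - 1 : ℕ) : Ordinal.{0})},
    mem_Iio.2 ((sInf_le_add_le _ _).trans_lt x.2)⟩

theorem collapse_le_iff {n : ℕ} {x : CountableOrdinal} {α : Ordinal.{0}} :
    (collapse n x : Ordinal.{0}) ≤ α ↔ (x : Ordinal.{0}) ≤ α + ((n - 1 : ℕ) : Ordinal.{0}) := by
  refine ⟨fun h => ?_, fun h => csInf_le' h⟩
  have hmem : (x : Ordinal.{0}) ≤ (collapse n x : Ordinal.{0}) + ((n - 1 : ℕ) : Ordinal.{0}) :=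
    csInf_mem (s := {α | (x : Ordinal.{0}) ≤ α + ((n - 1 : ℕ) : Ordinal.{0})}) 
      ⟨x, mem_ofPred.2 le_self_add⟩
  exact hmem.trans (by gcongr)

theorem collapse_le (n : ℕ) (x : CountableOrdinal) : collapse n x ≤ x :=
  collapse_le_iff.2 le_self_add

theorem exists_eq_collapse_add {n : ℕ} (hn : 1 ≤ n) (x : CountableOrdinal) :
    ∃ i < n, (x : Ordinal.{0}) = collapse n x + (i : Ordinal.{0}) := by
  have h1 : (x : Ordinal.{0}) - collapse n x ≤ ((n - 1 : ℕ) : Ordinal.{0}) :=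
    Ordinal.sub_le.2 (collapse_le_iff.1 le_rfl)
  obtain ⟨i, hi⟩ := Ordinal.lt_omega0.1 (h1.trans_lt (Ordinal.natCast_lt_omega0 _))
  rw [hi, Nat.cast_le] at h1
  refine ⟨i, by omega, ?_⟩
  rw [← hi, Ordinal.add_sub_cancel_of_le]
  exact collapse_le n x

theorem add_natCast_lt_omega_one (q : CountableOrdinal) (i : ℕ) :
    (q : Ordinal.{0}) + (i : Ordinal.{0}) < ω₁ :=
  (Cardinal.isSuccLimit_omega 1).add_natCast_lt q.2 i

theorem collapse_add {n i : ℕ} {q : CountableOrdinal}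
    (hq : Order.IsSuccLimit (q : Ordinal.{0})) (hi : i < n) :
    collapse n ⟨q + (i : Ordinal.{0}), add_natCast_lt_omega_one q i⟩ = q := by
  refine Subtype.ext (le_antisymm (collapse_le_iff.2 ?_) ?_)
  · have : (i : Ordinal.{0}) ≤ ((n - 1 : ℕ) : Ordinal.{0}) := by
      rw [Nat.cast_le]
      omega
    exact add_le_add_right this _
  · by_contra h
    rw [not_le] at h
    exact ((hq.add_natCast_lt h (n - 1)).trans_le le_self_add).not_ge (collapse_le_iff.1 le_rfl)

theorem encard_preimage_collapse_le {n : ℕ} (hn : 1 ≤ n) (q : CountableOrdinal) :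
    (collapse n ⁻¹' {q}).encard ≤ n := by
  have hsub : collapse n ⁻¹' {q} ⊆
      (fun i : ℕ => ⟨q + (i : Ordinal.{0}), add_natCast_lt_omega_one q i⟩) '' Iio n := by
    rintro x rfl
    obtain ⟨i, hi, h⟩ := exists_eq_collapse_add hn x
    exact ⟨i, hi, Subtype.ext h.symm⟩
  refine (encard_le_encard hsub).trans ((encard_image_le _ _).trans ?_)
  rw [← Finset.coe_Iio, encard_coe_eq_coe_finsetCard, Nat.card_Iio]

theorem countable_collapse_le (n : ℕ) (β : CountableOrdinal) :
    {x | collapse n x ≤ β}.Countable :=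
  (countable_Iic_of_lt_omega_one ⟨_, add_natCast_lt_omega_one β (n - 1)⟩).mono
    fun _ hx => collapse_le_iff.1 hx

/-- Each pair of a finite labelled set and a natural number has arbitrarily large codes. -/
theorem exists_coding : ∃ c : CountableOrdinal → Finset (CountableOrdinal × ℕ) × ℕ,
    ∀ e β, ∃ ξ > β, c ξ = e := by
  have hinf : Infinite CountableOrdinal := by
    by_contra h
    rw [not_infinite_iff_finite] at h
    exact not_countable_univ_Iio_omega_one (toFinite _).countable
  have h0 := Cardinal.infinite_iff.1 hinf
  have hcard : #((Finset (CountableOrdinal × ℕ) × ℕ) × CountableOrdinal) =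
      #CountableOrdinal := by
    simp only [Cardinal.mk_prod, Cardinal.mk_finset_of_infinite, Cardinal.lift_uzero,
      Cardinal.mk_nat, Cardinal.lift_aleph0, Cardinal.mul_aleph0_eq h0, Cardinal.lift_id,
      Cardinal.mul_eq_self h0]
  -- Pairing the data with an arbitrary ordinal makes the set of codes of each datum uncountable.
  obtain ⟨f⟩ := Cardinal.eq.1 hcard
  refine ⟨fun ξ => (f.symm ξ).1, fun e β => ?_⟩
  by_contra! hcon
  refine not_countable_univ_Iio_omega_one
    (((countable_Iic_of_lt_omega_one β).image fun ξ => (f.symm ξ).2).mono fun ζ _ => ?_)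
  refine ⟨f (e, ζ), ?_, by simp⟩
  by_contra hlt
  exact hcon _ (not_le.1 hlt) (by simp)

/-! ### The fan system of a guessing sequence -/

section Guessing

variable (n : ℕ) (S : CountableOrdinal → Set CountableOrdinal)
  (c : CountableOrdinal → Finset (CountableOrdinal × ℕ) × ℕ)

/-- The points labelled `i` in the sets coded by the members of `S q`. -/
def guessed (i : ℕ) (q : CountableOrdinal) : Set CountableOrdinal :=
  {y | ∃ ξ ∈ S q, (y, i) ∈ (c ξ).1}

open Classical in
/-- The rank announced by `S q`: one more than the number coded by some member of `S q`. It is of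
use only when all members code the same number. -/
noncomputable def guessRank (q : CountableOrdinal) : ℕ :=
  if h : (S q).Nonempty then (c h.some).2 + 1 else 0

/-- The guess at `q` can be used as a fan: its points lie below `q` and converge to `q`, no point
has two labels, and the announced rank exceeds the ranks of the points. -/
structure IsCoherent (q : CountableOrdinal) : Prop where
  collapse_lt : ∀ i, ∀ y ∈ guessed S c i q, collapse n y < q
  finite_le : ∀ β < q, {y | (∃ i, y ∈ guessed S c i q) ∧ collapse n y ≤ β}.Finite
  label_unique : ∀ y i i', y ∈ guessed S c i q → y ∈ guessed S c i' q → i = i'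
  rank_lt : ∀ i, ∀ y ∈ guessed S c i q, guessRank S c (collapse n y) < guessRank S c q

/-- The fan of `q + i` consists of the points labelled `i` by the guess at `q`, if this guess is
coherent; otherwise the points over `q` have empty fans, and so are isolated. -/
@[reducible]
noncomputable def guessSystem :
    FanSystem CountableOrdinal CountableOrdinal where
  proj := collapse n
  fan x := {y | IsCoherent n S c (collapse n x) ∧
    ∃ i : ℕ, (x : Ordinal.{0}) = collapse n x + (i : Ordinal.{0}) ∧
      y ∈ guessed S c i (collapse n x)}
  marks q := {y | IsCoherent n S c q ∧ ∃ i, y ∈ guessed S c i q}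
  rank x := guessRank S c (collapse n x)
  fan_subset := fun _ _ ⟨h, i, _, hy⟩ => ⟨h, i, hy⟩
  proj_lt := fun ⟨h, i, hy⟩ => h.collapse_lt i _ hy
  finite_le := fun {q β} hβ => by
    by_cases h : IsCoherent n S c q
    · exact (h.finite_le β hβ).subset fun y hy => ⟨hy.1.2, hy.2⟩
    · exact Set.finite_empty.subset fun y hy => h hy.1.1
  disjoint_fan := fun {x x'} hx hne => by
    rw [Set.disjoint_left]
    rintro y ⟨h, i, hi, hy⟩ ⟨-, i', hi', hy'⟩
    rw [← hx] at hi' hy'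
    rw [h.label_unique y i i' hy hy', ← hi'] at hi
    exact hne (Subtype.ext hi)
  rank_lt := fun ⟨h, i, _, hy⟩ => h.rank_lt i _ hy

variable {n S c}

/-- Codes `a η` of the sets `d (b η)`, with one common rank bound `r`, interleaved so that
later codes and (collapsed) labelled points are above all earlier ones. Any limit of such codes is
then also the limit of the labelled points. -/
theorem exists_interleaved_codes {A : Set CountableOrdinal}
    {d : CountableOrdinal → Finset (CountableOrdinal × ℕ)}
    {f : CountableOrdinal → CountableOrdinal} (rk : CountableOrdinal → ℕ)
    (hc : ∀ e β, ∃ ξ > β, c ξ = e)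
    (hA : ∀ β, ∃ α ∈ A, β < α ∧ ∀ e ∈ d α, β < f e.1) (β₀ : CountableOrdinal) :
    ∃ (r : ℕ) (a b : CountableOrdinal → CountableOrdinal),
      StrictMono a ∧ StrictMono b ∧ (∀ η, β₀ < a η) ∧ (∀ η, b η ∈ A) ∧
      (∀ η, c (a η) = (d (b η), r)) ∧ (∀ η, ∀ e ∈ d (b η), rk (f e.1) ≤ r) ∧
      ∀ ζ η, ζ < η → (∀ e ∈ d (b ζ), f e.1 < a η) ∧ (∀ e ∈ d (b η), a ζ < f e.1) ∧
        ∀ e ∈ d (b ζ), ∀ e' ∈ d (b η), f e.1 < f e'.1 := by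
  -- Otherwise each `r` fails beyond some `b r`, and all `b r` have a common upper bound.
  obtain ⟨r, hr⟩ : ∃ r, ∀ β, ∃ α ∈ A, β < α ∧ ∀ e ∈ d α, β < f e.1 ∧ rk (f e.1) ≤ r := by
    by_contra! hcon
    choose b hb using hcon
    obtain ⟨β, hβ⟩ := exists_forall_lt_of_countable (countable_range b)
    obtain ⟨α, hα, hβα, h⟩ := hA β
    obtain ⟨e, he, hlt⟩ := hb ((d α).sup fun e => rk (f e.1)) α hα
      ((hβ _ (mem_range_self _)).trans hβα)
    exact (Finset.le_sup (f := fun e => rk (f e.1)) he).not_gt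
      (hlt ((hβ _ (mem_range_self _)).trans (h e he)))
  let Z := {z : CountableOrdinal × CountableOrdinal //
    β₀ < z.1 ∧ z.2 ∈ A ∧ c z.1 = (d z.2, r) ∧ ∀ e ∈ d z.2, rk (f e.1) ≤ r}
  have hbound : ∀ s : Set Z, s.Countable → ∃ β, β₀ < β ∧
      ∀ w ∈ s, w.1.1 < β ∧ w.1.2 < β ∧ ∀ e ∈ d w.1.2, f e.1 < β := by
    intro s hs
    let t : Z → Set CountableOrdinal := fun w =>
      {w.1.1, w.1.2} ∪ (fun e => f e.1) '' {e | e ∈ d w.1.2}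
    have ht : ∀ w, (t w).Countable := fun w =>
      (toFinite _).countable.union ((d w.1.2).finite_toSet.countable.image _)
    obtain ⟨β, hβ⟩ := exists_forall_lt_of_countable (hs.biUnion fun w _ => ht w)
    have hβ' : ∀ w ∈ s, ∀ u ∈ t w, u < β := fun w hw u hu => hβ u (mem_biUnion hw hu)
    obtain ⟨γ, hγ⟩ := exists_forall_lt_of_countable (s := {β₀, β}) (toFinite _).countable
    refine ⟨γ, hγ _ (by simp), fun w hw => ?_⟩
    have hlt : ∀ u ∈ t w, u < γ := fun u hu => (hβ' w hw u hu).trans (hγ β (by simp))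
    exact ⟨hlt _ (by simp [t]), hlt _ (by simp [t]), fun e he =>
      hlt _ (mem_union_right _ (mem_image_of_mem _ he))⟩
  obtain ⟨h, hh⟩ := exists_transfinite_sequence (Z := Z)
    (fun w z => (w.1.1 < z.1.1 ∧ w.1.2 < z.1.2) ∧ (∀ e ∈ d w.1.2, f e.1 < z.1.1) ∧
      (∀ e ∈ d z.1.2, w.1.1 < f e.1) ∧
      ∀ e ∈ d w.1.2, ∀ e' ∈ d z.1.2, f e.1 < f e'.1) (by
      intro s hs
      obtain ⟨β, h0, hβ⟩ := hbound s hs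
      obtain ⟨α, hα, hβα, h⟩ := hr β
      obtain ⟨ξ, hξ, hcξ⟩ := hc (d α, r) β
      refine ⟨⟨(ξ, α), h0.trans hξ, hα, hcξ, fun e he => (h e he).2⟩,
        fun w hw => ⟨⟨(hβ w hw).1.trans hξ, (hβ w hw).2.1.trans hβα⟩,
          fun e he => ((hβ w hw).2.2 e he).trans hξ, fun e he => (hβ w hw).1.trans (h e he).1,
          fun e he e' he' => ((hβ w hw).2.2 e he).trans (h e' he').1⟩⟩)
  exact ⟨r, fun η => (h η).1.1, fun η => (h η).1.2, fun ζ η hlt => (hh ζ η hlt).1.1,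
    fun ζ η hlt => (hh ζ η hlt).1.2, fun η => (h η).2.1, fun η => (h η).2.2.1,
    fun η => (h η).2.2.2.1, fun η => (h η).2.2.2.2, fun ζ η hlt => (hh ζ η hlt).2⟩

/-- Apply `♣` to the set of interleaved codes: the guessed subset of it decodes to a coherent guess
of infinitely many members of the family. -/
theorem guesses_guessSystem (hn : 1 ≤ n)
    (hS : ∀ α : CountableOrdinal, Order.IsSuccLimit (α : Ordinal.{0}) →
      S α ⊆ Iio α ∧ (S α).Infinite ∧ ∀ β < α, (S α ∩ Iic β).Finite)
    (hS' : ∀ W : Set CountableOrdinal, ¬ W.Countable →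
      ∃ α : CountableOrdinal, Order.IsSuccLimit (α : Ordinal.{0}) ∧ S α ⊆ W)
    (hc : ∀ e β, ∃ ξ > β, c ξ = e) :
    @FanSystem.Guesses _ (guessSystem n S c) n := by
  intro A d hd hA β₀
  have hA' : ∀ β, ∃ α ∈ A, β < α ∧ ∀ e ∈ d α, β < collapse n e.1 := hA
  obtain ⟨r, a, b, ha, hb, hβ₀, hbA, hcode, hrk, hinter⟩ :=
    exists_interleaved_codes (f := collapse n) (guessRank S c) hc hA' β₀
  obtain ⟨q, hq, hSq⟩ := hS' (range a) (fun hcount => by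
    refine not_countable_univ_Iio_omega_one ?_
    simpa using hcount.preimage ha.injective)
  obtain ⟨hlt, hinf, hfin⟩ := hS q hq
  let B : Set CountableOrdinal := {η | a η ∈ S q}
  have hB : ∀ ξ ∈ S q, ∃ η ∈ B, a η = ξ := fun ξ hξ => by
    obtain ⟨η, rfl⟩ := hSq hξ
    exact ⟨η, hξ, rfl⟩
  have hBinf : B.Infinite := Infinite.of_image a (hinf.mono fun ξ hξ => hB ξ hξ)
  have hcof : ∀ γ < q, ∃ η ∈ B, γ < a η := by
    intro γ hγ
    obtain ⟨ξ, hξ, hγξ⟩ := (hinf.sdiff (hfin γ hγ)).nonempty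
    obtain ⟨η, hη, rfl⟩ := hB ξ hξ
    exact ⟨η, hη, not_le.1 fun hle => hγξ ⟨hξ, hle⟩⟩
  have hBlt : ∀ η ∈ B, ∀ e ∈ d (b η), collapse n e.1 < q := by
    intro η hη e he
    obtain ⟨η', hη', hlt'⟩ := hcof _ (hlt hη)
    exact ((hinter η η' (ha.lt_iff_lt.1 hlt')).1 e he).trans (hlt hη')
  have hBfin : ∀ γ < q, {η ∈ B | ∃ e ∈ d (b η), collapse n e.1 ≤ γ}.Finite := by
    intro γ hγ
    obtain ⟨η₀, hη₀, hγη₀⟩ := hcof γ hγ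
    refine Set.Finite.subset ((hfin _ (hlt hη₀)).preimage ha.injective.injOn) ?_
    rintro η ⟨hη, e, he, hle⟩
    refine ⟨hη, ha.monotone (le_of_not_gt fun hlt' => ?_)⟩
    exact (hγη₀.trans ((hinter η₀ η hlt').2.1 e he)).not_ge hle
  have hguess : ∀ i y, y ∈ guessed S c i q ↔ ∃ α ∈ b '' B, (y, i) ∈ d α := by
    intro i y
    constructor
    · rintro ⟨ξ, hξ, hy⟩
      obtain ⟨η, hη, rfl⟩ := hB ξ hξ
      rw [hcode] at hy
      exact ⟨_, mem_image_of_mem b hη, hy⟩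
    · rintro ⟨_, ⟨η, hη, rfl⟩, hy⟩
      exact ⟨_, hη, by rwa [hcode]⟩
  have huniq : ∀ α ∈ b '' B, ∀ α' ∈ b '' B, ∀ y i i', (y, i) ∈ d α → (y, i') ∈ d α' → i = i' := by
    rintro _ ⟨η, -, rfl⟩ _ ⟨η', -, rfl⟩ y i i' hy hy'
    rcases lt_trichotomy η η' with hlt' | rfl | hlt'
    · exact absurd ((hinter _ _ hlt').2.2 _ hy _ hy') (lt_irrefl _)
    · exact hd _ y i i' hy hy'
    · exact absurd ((hinter _ _ hlt').2.2 _ hy' _ hy) (lt_irrefl _)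
  have hrank : guessRank S c q = r + 1 := by
    rw [guessRank, dif_pos hinf.nonempty]
    obtain ⟨η, hη⟩ := hSq hinf.nonempty.some_mem
    rw [← hη, hcode]
  have hTfin : ∀ γ < q, {α ∈ b '' B | ∃ e ∈ d α, collapse n e.1 ≤ γ}.Finite := by
    intro γ hγ
    refine ((hBfin γ hγ).image b).subset ?_
    rintro _ ⟨⟨η, hη, rfl⟩, he⟩
    exact ⟨η, ⟨hη, he⟩, rfl⟩
  have hcoh : IsCoherent n S c q := by
    refine ⟨fun i y hy => ?_, fun γ hγ => ?_, fun y i i' hy hy' => ?_, fun i y hy => ?_⟩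
    · obtain ⟨_, ⟨η, hη, rfl⟩, hy⟩ := (hguess i y).1 hy
      exact hBlt η hη _ hy
    · refine ((hTfin γ hγ).biUnion fun α _ => (d α).finite_toSet.image Prod.fst).subset ?_
      rintro y ⟨⟨i, hy⟩, hle⟩
      obtain ⟨α, hα, hy⟩ := (hguess i y).1 hy
      exact mem_biUnion (x := α) ⟨hα, _, hy, hle⟩ ⟨_, hy, rfl⟩
    · obtain ⟨α, hα, hy⟩ := (hguess i y).1 hy
      obtain ⟨α', hα', hy'⟩ := (hguess i' y).1 hy'
      exact huniq α hα α' hα' y i i' hy hy'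
    · obtain ⟨_, ⟨η, hη, rfl⟩, hy⟩ := (hguess i y).1 hy
      rw [hrank]
      exact Nat.lt_succ_iff.2 (hrk η _ hy)
  obtain ⟨η₀, hη₀⟩ := hBinf.nonempty
  refine ⟨q, (hβ₀ η₀).trans (hlt hη₀), b '' B, image_subset_iff.2 fun η _ => hbA η,
    fun i => ⟨q + (i : Ordinal.{0}), add_natCast_lt_omega_one q i⟩, ?_⟩
  let _ := guessSystem n S c
  exact
    { infinite := hBinf.image hb.injective.injOn
      finite_le := hTfin
      marks_eq := by
        ext y
        refine ⟨fun ⟨_, i, hy⟩ => ?_,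
          fun ⟨α, hα, i, hy⟩ => ⟨hcoh, i, (hguess i y).2 ⟨α, hα, hy⟩⟩⟩
        obtain ⟨α, hα, hy⟩ := (hguess i y).1 hy
        exact ⟨α, hα, i, hy⟩
      injOn := by
        intro i _ i' _ hii'
        simpa using congrArg Subtype.val hii'
      proj_eq := fun i hi => collapse_add hq hi
      exists_eq := by
        rintro x rfl
        obtain ⟨i, hi, hxi⟩ := exists_eq_collapse_add hn x
        exact ⟨i, hi, Subtype.ext hxi⟩
      label_unique := huniq
      fan_eq := by
        intro i hi
        have hmem : ∀ (x : CountableOrdinal), collapse n x = q →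
            (x : Ordinal.{0}) = q + (i : Ordinal.{0}) → ∀ y,
              (IsCoherent n S c (collapse n x) ∧
                ∃ i' : ℕ, (x : Ordinal.{0}) = collapse n x + (i' : Ordinal.{0}) ∧
                  y ∈ guessed S c i' (collapse n x)) ↔ y ∈ guessed S c i q := by
          rintro x rfl hx y
          refine ⟨?_, fun hy => ⟨hcoh, i, hx, hy⟩⟩
          rintro ⟨-, i', hi', hy⟩
          obtain rfl : i = i' := by
            rw [hx] at hi'
            simpa using hi'
          exact hy
        ext y
        exact (hmem _ (collapse_add hq hi) rfl y).trans (hguess i y) }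

end Guessing

/-! ### One-point compactification -/

namespace FanSystem

attribute [local instance] topology

/-- The topology of the one-point compactification of `X`, carried over to `K`, of which `X` is the
complement of a point. -/
theorem exists_onePoint_topology {X Y K : Type*} [LinearOrder Y] [FanSystem X Y] {j : X → K}
    {pt : K} (hinj : Function.Injective j) (hr : range j = {pt}ᶜ) :
    ∃ _ : TopologicalSpace K, CompactSpace K ∧ T2Space K ∧ IsOpenEmbedding j := by
  have := t2Space (X := X)
  have := locallyCompactSpace (X := X)
  have hjpt : ∀ y, j y ≠ pt := fun y => by
    have : j y ∈ range j := mem_range_self y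
    rwa [hr] at this
  let f : OnePoint X → K := fun o => OnePoint.elim o pt j
  have hf : Function.Bijective f := by
    constructor
    · intro a b hab
      induction a using OnePoint.rec <;> induction b using OnePoint.rec
      · rfl
      · exact absurd hab.symm (hjpt _)
      · exact absurd hab (hjpt _)
      · exact congrArg _ (hinj hab)
    · intro y
      by_cases h : y = pt
      · exact ⟨OnePoint.infty, h.symm⟩
      · obtain ⟨x, rfl⟩ := (hr ▸ h : y ∈ range j)
        exact ⟨x, rfl⟩
  let e := Equiv.ofBijective f hf
  let τ : TopologicalSpace K := TopologicalSpace.induced e.symm inferInstance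
  let h : K ≃ₜ OnePoint X := e.symm.toHomeomorphOfIsInducing ⟨rfl⟩
  exact ⟨τ, h.symm.compactSpace, h.symm.t2Space,
    h.symm.isOpenEmbedding.comp OnePoint.isOpenEmbedding_coe⟩

theorem isClosed_proj_le_or_eq {X Y K : Type*} [LinearOrder Y] [FanSystem X Y]
    [TopologicalSpace K] {j : X → K} {pt : K} (hj : IsOpenEmbedding j) (hr : range j = {pt}ᶜ)
    (α : Y) : IsClosed (j '' {x | proj x ≤ α} ∪ {pt}) := by
  have hopen := hj.isOpenMap _ (isOpen_lt_proj (X := X) α)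
  convert hopen.isClosed_compl using 1
  ext y
  by_cases h : y = pt
  · have : y ∉ range j := by simp [hr, h]
    refine iff_of_true (.inr h) fun ⟨x, _, hx⟩ => this ⟨x, hx⟩
  · obtain ⟨x, rfl⟩ := (hr ▸ h : y ∈ range j)
    simp [hj.injective.eq_iff, h]

theorem continuous_proj_induced {X Y K : Type*} [LinearOrder Y] [FanSystem X Y]
    [t : TopologicalSpace K] {j : X → K} (hj : IsOpenEmbedding j) :
    Continuous[TopologicalSpace.induced j t, Preorder.topology Y] (proj : X → Y) := by
  rw [← hj.eq_induced]
  exact @continuous_proj X Y _ _ (Preorder.topology Y) (@OrderTopology.mk _ (_) _ rfl)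

end FanSystem

/-- `♣` in terms of the type of countable ordinals. -/
theorem Clubsuit.exists_guessing (hclub : Clubsuit) :
    ∃ S : CountableOrdinal → Set CountableOrdinal,
      (∀ α : CountableOrdinal, Order.IsSuccLimit (α : Ordinal.{0}) →
        S α ⊆ Iio α ∧ (S α).Infinite ∧ ∀ β < α, (S α ∩ Iic β).Finite) ∧
      ∀ W : Set CountableOrdinal, ¬ W.Countable →
        ∃ α : CountableOrdinal, Order.IsSuccLimit (α : Ordinal.{0}) ∧ S α ⊆ W := by
  obtain ⟨S, hS, hS'⟩ := hclub
  have hinj := Subtype.val_injective (p := fun x : Ordinal.{0} => x ∈ Iio (ω₁ : Ordinal.{0}))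
  refine ⟨fun α => Subtype.val ⁻¹' S α, fun α hα => ?_, fun W hW => ?_⟩
  · obtain ⟨h1, h2, h3⟩ := hS α α.2 hα
    refine ⟨fun x hx => h1 hx, h2.preimage fun x hx => ?_, fun β hβ => ?_⟩
    · exact ⟨⟨x, mem_Iio.2 (lt_trans (h1 hx) α.2)⟩, rfl⟩
    · exact Finite.subset ((h3 β hβ).preimage hinj.injOn) fun x hx => ⟨hx.1, hx.2⟩
  · have hsubW : Subtype.val '' W ⊆ Iio (ω₁ : Ordinal.{0}) := by
      rintro _ ⟨x, -, rfl⟩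
      exact x.2
    obtain ⟨α, hα, hlim, hsub⟩ := hS' _ hsubW fun h =>
      hW (hinj.preimage_image W ▸ h.preimage hinj)
    refine ⟨⟨α, hα⟩, hlim, fun x hx => ?_⟩
    obtain ⟨y, hy, hyx⟩ := hsub hx
    rwa [← hinj hyx]

theorem mk_Iic_omega_one_le : #(Iic (ω₁ : Ordinal.{0})) ≤ ℵ₁ := by
  rw [← Iio_union_right, union_singleton]
  refine Cardinal.mk_insert_le.trans ?_
  rw [Cardinal.mk_Iio_ordinal, Ordinal.card_omega, Cardinal.lift_aleph, Ordinal.lift_one,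
    Cardinal.add_one_eq (Cardinal.aleph0_le_aleph 1)]

theorem mainTheorem6 (hclub : Clubsuit) (n : ℕ) (hn : 1 ≤ n) :
    ∃ τ : TopologicalSpace (Iic (ω₁ : Ordinal.{0})),
      @CompactSpace _ τ ∧ @T2Space _ τ ∧
      @IsScatteredSpace _ τ ∧ @HasHeight _ τ (ω + 1) ∧
      @topWeight _ τ = ℵ₁ ∧
      ¬ @TopologicalSpace.SeparableSpace _ τ ∧
      @IsDiverseSpace _ τ (n + 1) ∧
      (∀ α : Ordinal.{0}, α < ω₁ →
        IsClosed[τ] {x : Iic (ω₁ : Ordinal.{0}) |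
          (x : Ordinal.{0}) ≤ α + ((n - 1 : ℕ) : Ordinal.{0}) ∨ (x : Ordinal.{0}) = ω₁}) ∧
      ∃ φ : Iio (ω₁ : Ordinal.{0}) → Iio (ω₁ : Ordinal.{0}),
        Continuous[TopologicalSpace.induced (inclusion Iio_subset_Iic_self) τ,
          Preorder.topology (Iio (ω₁ : Ordinal.{0}))] φ ∧
        ∀ α, (φ ⁻¹' {α}).encard ≤ n := by
  obtain ⟨S, hS, hS'⟩ := hclub.exists_guessing
  obtain ⟨c, hc⟩ := exists_coding
  let F := guessSystem n S c
  have hg : FanSystem.Guesses CountableOrdinal n := guesses_guessSystem hn hS hS' hc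
  let j : CountableOrdinal → Iic (ω₁ : Ordinal.{0}) := inclusion Iio_subset_Iic_self
  have hr : range j = {⟨ω₁, mem_Iic.2 le_rfl⟩}ᶜ := by
    ext y
    constructor
    · rintro ⟨x, rfl⟩ h
      exact (mem_Iio.1 x.2).ne (congrArg Subtype.val h)
    · intro h
      exact ⟨⟨y, lt_of_le_of_ne y.2 fun h' => h (Subtype.ext h')⟩, rfl⟩
  obtain ⟨τ, hcomp, hT2, hj⟩ := FanSystem.exists_onePoint_topology (inclusion_injective _) hr
  have hsep := FanSystem.not_separableSpace_of_guesses hn hg hj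
  refine ⟨τ, hcomp, hT2, FanSystem.isScatteredSpace_of_range hj hr,
    FanSystem.hasHeight_of_guesses hn hg hj hr,
    topWeight_eq_aleph_one mk_Iic_omega_one_le hsep, hsep,
    FanSystem.isDiverseSpace_of_guesses hn hg hj hr (countable_collapse_le n), fun α hα => ?_,
    collapse n, FanSystem.continuous_proj_induced hj, encard_preimage_collapse_le hn⟩
  convert FanSystem.isClosed_proj_le_or_eq hj hr ⟨α, hα⟩ using 1
  ext y
  by_cases h : y = ⟨ω₁, mem_Iic.2 le_rfl⟩
  · exact iff_of_true (.inr (congrArg Subtype.val h)) (.inr h)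
  · obtain ⟨x, rfl⟩ := (hr ▸ h : y ∈ range j)
    have hx : (x : Ordinal.{0}) ≠ ω₁ := (mem_Iio.1 x.2).ne
    have hle : collapse n x ≤ ⟨α, hα⟩ ↔ (x : Ordinal.{0}) ≤ α + ((n - 1 : ℕ) : Ordinal.{0}) :=
      collapse_le_iff
    constructor
    · rintro (h' | h')
      · exact .inl ⟨x, hle.2 h', rfl⟩
      · exact absurd h' hx
    · rintro (⟨x', h', hxx'⟩ | h')
      · rw [inclusion_injective _ hxx'] at h'
        exact .inl (hle.1 h')
      · exact absurd h' h
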